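/- An index is a finite sequence $\mathbf k=(k_1,\dots,k_r)$ of positive integers with $r\ge 1$; its depth is $\mathrm{dep}(\mathbf k)=r$. For an index with $k_r\ge 2$ let $$\zeta(k_1,\dots,k_r)=\sum_{0<m_1<\cdots<m_r}\frac{1}{m_1^{k_1}\cdots m_r^{k_r}},$$ and for any index and $0\le z<1$ let $\mathrm{Li}_{k_1,\dots,k_r}(z)=\sum_{0<m_1<\cdots<m_r}\frac{z^{m_r}}{m_1^{k_1}\cdots m_r^{k_r}}$. For $s>0$ the Arakawa–Kaneko multiple zeta function is $$\xi(k_1,\dots,k_r;s)=\frac{1}{\Gamma(s)}\int_0^\infty \frac{x^{s-1}}{e^x-1}\,\mathrm{Li}_{k_1,\dots,k_r}(1-e^{-x})\,dx .$$ For $t\in\mathbb R$ and an integer $m\ge 1$ the $t$-Arakawa–Kaneko multiple zeta value is $$\xi_t(k_1,\dots,k_r;m)=\sum_{\mathbf k'}t^{\,r-\mathrm{dep}(\mathbf k')}\,\xi(\mathbf k';m),$$ where $\mathbf k'$ runs over all indices of the form $(k_1\,\Box\,k_2\,\Box\cdots\Box\,k_r)$ in which each $\Box$ is filled by a comma ","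 or by a plus sign "+" (with $0^0=1$). **Theorem.** For all integers $k,l\ge 0$ and all $t\in\mathbb R$, $$\sum_{\substack{r+m=k\\ r,m\ge 0}}(-1)^m\sum_{\substack{k_1+\cdots+k_{r+1}=l\\ k_i\ge 0}}\xi_t(k_1+1,\dots,k_{r+1}+1;m+1)=\sum_{\substack{a+b=k\\ a,b\ge 0}}(-1)^a t^b\binom{b+l}{b}\,\zeta(\{1\}^a,b+l+2),$$ where $\{1\}^a$ denotes $a$ entries equal to $1$. In particular (the case $t=0$, with $\xi_0=\xi$), $$\sum_{\substack{r+m=k\\ r,m\ge 0}}(-1)^m\sum_{\substack{k_1+\cdots+k_{r+1}=l\\ k_i\ge 0}}\xi(k_1+1,\dots,k_{r+1}+1;m+1)=(-1)^k\,\zeta(\{1\}^k,l+2).$$ -/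

import Mathlib

/-- The multiple zeta value `ζ(k₁, …, k_r) = ∑_{0 < m₁ < ⋯ < m_r} 1 / (m₁ ^ k₁ ⋯ m_r ^ k_r)`
of the index `k = [k₁, …, k_r]`. -/
noncomputable def multiZeta (k : List ℕ) : ℝ :=
  ∑' m : {m : Fin k.length → ℕ // StrictMono m ∧ ∀ i, 0 < m i},
    1 / ∏ i, (m.1 i : ℝ) ^ k.get i

/-- The multiple polylogarithm
`Li_{k₁, …, k_r}(z) = ∑_{0 < m₁ < ⋯ < m_r} z ^ m_r / (m₁ ^ k₁ ⋯ m_r ^ k_r)`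
of the index `[k₁, …, k_r]`, with the convention that it is `1` for the empty index. -/
noncomputable def multiPolylog : List ℕ → ℝ → ℝ
  | [], _ => 1
  | a :: k, z =>
    ∑' m : {m : Fin (k.length + 1) → ℕ // StrictMono m ∧ ∀ i, 0 < m i},
      z ^ m.1 (Fin.last k.length) / ∏ i, (m.1 i : ℝ) ^ (a :: k).get i

/-- The Arakawa–Kaneko multiple zeta function (at a real argument `s > 0`)
`ξ(k₁, …, k_r; s) = 1 / Γ(s) * ∫₀^∞ x ^ (s - 1) / (e ^ x - 1) * Li_{k₁, …, k_r}(1 - e ^ (-x)) dx`. -/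
noncomputable def arakawaKaneko (k : List ℕ) (s : ℝ) : ℝ :=
  1 / Real.Gamma s * ∫ x in Set.Ioi (0 : ℝ),
    x ^ (s - 1) / (Real.exp x - 1) * multiPolylog k (1 - Real.exp (-x))

/-- All `(a □ k₁ □ ⋯ □ k_r)` with each box filled by a comma or by a plus sign: the first box is
either a comma, which makes `a` the first entry, or a plus sign, which replaces `a, k₁`
by `a + k₁`. -/
def boxFillingsFrom : ℕ → List ℕ → List (List ℕ)
  | a, [] => [[a]]
  | a, b :: k => (boxFillingsFrom b k).map (a :: ·) ++ boxFillingsFrom (a + b) k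

/-- The list of all indices `(k₁ □ k₂ □ ⋯ □ k_r)` in which each box is filled by a comma or by a
plus sign (one entry for each of the `2 ^ (r - 1)` fillings). -/
def boxFillings : List ℕ → List (List ℕ)
  | [] => [[]]
  | a :: k => boxFillingsFrom a k

/-- The `t`-Arakawa–Kaneko multiple zeta value
`ξ_t(k₁, …, k_r; m) = ∑ t ^ (r - dep k') * ξ(k'; m)`, the sum being over all indices
`k' = (k₁ □ k₂ □ ⋯ □ k_r)` in which each box is filled by a comma or by a plus sign. -/
noncomputable def tArakawaKaneko (t : ℝ) (k : List ℕ) (m : ℕ) : ℝ :=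
  ((boxFillings k).map fun k' => t ^ (k.length - k'.length) * arakawaKaneko k' m).sum

open PowerSeries Finset

/-! Applying the functional `h ↦ ∑ coeff n h / n` to one identity of formal power series gives both
sides. At `z = 1 - exp (-x)` this functional is integration against `1 / (exp x - 1)`, and the
series of `Li_{{1}ᵐ}` becomes `x ^ m / m!`. Hence `Li_{{1}ᵐ} * Li_k` is sent to `ξ(k; m + 1)`
(`hasSum_arakawaKaneko`), while a polylogarithm alone is sent to the zeta value with last entry
raised by one (`hasSum_multiZeta`).

The series identity is `productSide_eq_polylogSide`. Write `D = X * d/dX` and `F r l` for the sum of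
`t`-interpolated polylogarithms. Then `D (F (r+1) (l+1)) = F (r+1) l + (X/(1-X) + t) * F r (l+1)`,
whereas `D Li_{{1}ᵐ⁺¹} = X/(1-X) * Li_{{1}ᵐ}`. In the alternating sum of products the `X/(1-X)`
terms cancel, leaving `D P (k+1) (l+1) = P (k+1) l + t * P k (l+1)`. The zeta side obeys the same
recursion by Pascal's rule, and constant terms vanish. -/

/-! ### Operators on formal power series -/

/-- Division of the `n`-th coefficient of a power series by `n` (the constant term is killed):
the inverse of `X * d/dX`. -/
noncomputable def divIndex : Module.End ℝ ℝ⟦X⟧ where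
  toFun h := PowerSeries.mk fun n => coeff n h / n
  map_add' f g := by ext n; simp [add_div]
  map_smul' c f := by ext n; simp [mul_div_assoc]

/-- The power series `X + X ^ 2 + X ^ 3 + ⋯`. -/
noncomputable def geomTail : ℝ⟦X⟧ := PowerSeries.mk fun n => if n = 0 then 0 else 1

/-- The operator replacing the coefficients of a power series by their strict partial sums. -/
noncomputable def strictSum : Module.End ℝ ℝ⟦X⟧ := LinearMap.mulLeft ℝ geomTail

/-- The Euler derivation `X * d/dX`. -/
noncomputable def eulerDeriv : Derivation ℝ ℝ⟦X⟧ ℝ⟦X⟧ := (X : ℝ⟦X⟧) • PowerSeries.derivative ℝ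

theorem coeff_divIndex (n : ℕ) (h : ℝ⟦X⟧) : coeff n (divIndex h) = coeff n h / n := by
  simp [divIndex]

theorem coeff_divIndex_pow (a n : ℕ) (h : ℝ⟦X⟧) :
    coeff n ((divIndex ^ a) h) = coeff n h / (n : ℝ) ^ a := by
  induction a with
  | zero => simp
  | succ a ih =>
    rw [pow_succ', Module.End.mul_apply, coeff_divIndex, ih, pow_succ, div_div]

theorem strictSum_apply (h : ℝ⟦X⟧) : strictSum h = geomTail * h := rfl

theorem coeff_strictSum (n : ℕ) (h : ℝ⟦X⟧) :
    coeff n (strictSum h) = ∑ m ∈ range n, coeff m h := by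
  rw [strictSum_apply, mul_comm, coeff_mul, Finset.Nat.sum_antidiagonal_eq_sum_range_succ_mk,
    Finset.sum_range_succ]
  simp only [geomTail, coeff_mk]
  rw [Nat.sub_self, if_pos rfl, mul_zero, add_zero]
  refine Finset.sum_congr rfl fun m hm => ?_
  rw [Finset.mem_range] at hm
  rw [if_neg (by omega), mul_one]

theorem coeff_eulerDeriv (n : ℕ) (h : ℝ⟦X⟧) : coeff n (eulerDeriv h) = n * coeff n h := by
  change coeff n (X * PowerSeries.derivative ℝ h) = _
  cases n with
  | zero => simp
  | succ n => rw [coeff_succ_X_mul, coeff_derivative]; push_cast; ring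

theorem eulerDeriv_divIndex {h : ℝ⟦X⟧} (hh : coeff 0 h = 0) : eulerDeriv (divIndex h) = h := by
  ext n
  rw [coeff_eulerDeriv, coeff_divIndex]
  rcases Nat.eq_zero_or_pos n with rfl | hn
  · rw [hh]; simp
  · field_simp

/-- The Euler derivation kills only constants; this is the integration step of every later
induction. -/
theorem eq_of_eulerDeriv_eq {f g : ℝ⟦X⟧} (h : eulerDeriv f = eulerDeriv g)
    (h0 : coeff 0 f = coeff 0 g) : f = g := by
  ext n
  rcases Nat.eq_zero_or_pos n with rfl | hn
  · exact h0
  · have := congrArg (coeff n) h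
    rw [coeff_eulerDeriv, coeff_eulerDeriv] at this
    exact mul_left_cancel₀ (by positivity) this

theorem coeff_zero_divIndex (h : ℝ⟦X⟧) : coeff 0 (divIndex h) = 0 := by
  simp [coeff_divIndex]

theorem coeff_zero_strictSum (h : ℝ⟦X⟧) : coeff 0 (strictSum h) = 0 := by
  simp [coeff_strictSum]

theorem coeff_zero_divIndex_pow_strictSum (a : ℕ) (h : ℝ⟦X⟧) :
    coeff 0 ((divIndex ^ a) (strictSum h)) = 0 := by
  rw [coeff_divIndex_pow, coeff_zero_strictSum, zero_div]

theorem eulerDeriv_divIndex_pow_strictSum (a : ℕ) (h : ℝ⟦X⟧) :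
    eulerDeriv ((divIndex ^ (a + 1)) (strictSum h)) = (divIndex ^ a) (strictSum h) := by
  rw [pow_succ', Module.End.mul_apply, eulerDeriv_divIndex (coeff_zero_divIndex_pow_strictSum _ _)]

/-! ### Operators of indices and of box fillings -/

/-- The operator sending `1` to the generating series of the multiple polylogarithm of an index. -/
noncomputable def polylogOp : List ℕ → Module.End ℝ ℝ⟦X⟧
  | [] => 1
  | a :: k => polylogOp k * (divIndex ^ a * strictSum)

/-- The operator attached to all fillings of the boxes in front of the entries of `k`. -/
noncomputable def boxOp (t : ℝ) : List ℕ → Module.End ℝ ℝ⟦X⟧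
  | [] => 1
  | b :: k => boxOp t k * (divIndex ^ b * (strictSum + t • 1))

theorem length_le_of_mem_boxFillingsFrom {a : ℕ} {k k' : List ℕ} (h : k' ∈ boxFillingsFrom a k) :
    k'.length ≤ k.length + 1 := by
  induction k generalizing a k' with
  | nil => simp_all [boxFillingsFrom]
  | cons b k ih =>
    rw [boxFillingsFrom, List.mem_append, List.mem_map] at h
    rcases h with ⟨k'', h, rfl⟩ | h
    · simpa using ih h
    · have := ih h
      simp only [List.length_cons]; omega

theorem sum_boxFillingsFrom_cons {M : Type*} [AddCommGroup M] [Module ℝ M] (t : ℝ) (a b : ℕ)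
    (k : List ℕ) (f : List ℕ → M) :
    ((boxFillingsFrom a (b :: k)).map fun k' => t ^ (k.length + 2 - k'.length) • f k').sum =
      ((boxFillingsFrom b k).map fun k' => t ^ (k.length + 1 - k'.length) • f (a :: k')).sum +
      t • ((boxFillingsFrom (a + b) k).map fun k' => t ^ (k.length + 1 - k'.length) • f k').sum := by
  rw [boxFillingsFrom, List.map_append, List.sum_append, List.map_map, List.smul_sum,
    List.map_map]
  congr 2
  · refine List.map_congr_left fun k' _ => ?_
    simp
  · refine List.map_congr_left fun k' hk' => ?_
    -- The length bound keeps the truncated subtraction honest, so that one factor `t` can be split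
    -- off.
    have := length_le_of_mem_boxFillingsFrom hk'
    rw [Function.comp_apply, smul_smul, ← pow_succ']
    congr 2; omega

/-- A comma inserts `strictSum` between two powers of `divIndex`; a plus sign inserts the scalar `t`
and lets the powers merge. Each box thus contributes the factor `strictSum + t • 1`. -/
theorem sum_boxFillingsFrom_polylogOp (t : ℝ) (a : ℕ) (k : List ℕ) (g : ℝ⟦X⟧) :
    ((boxFillingsFrom a k).map fun k' => t ^ (k.length + 1 - k'.length) • polylogOp k' g).sum =
      boxOp t k ((divIndex ^ a) (strictSum g)) := by
  induction k generalizing a g with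
  | nil => simp [boxFillingsFrom, polylogOp, boxOp]
  | cons b k ih =>
    rw [List.length_cons, sum_boxFillingsFrom_cons t a b k fun k' => polylogOp k' g, ih]
    simp only [polylogOp, Module.End.mul_apply]
    rw [ih, boxOp, ← map_smul, ← map_add]
    simp only [Module.End.mul_apply, LinearMap.add_apply, LinearMap.smul_apply,
      Module.End.one_apply, map_add, map_smul]
    simp only [add_comm a b, pow_add, Module.End.mul_apply]

theorem sum_boxFillingsFrom_zero (f : List ℕ → ℝ) (a : ℕ) (k : List ℕ) :
    ((boxFillingsFrom a k).map fun k' => (0 : ℝ) ^ (k.length + 1 - k'.length) • f k').sum =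
      f (a :: k) := by
  induction k generalizing a f with
  | nil => simp [boxFillingsFrom]
  | cons b k ih =>
    rw [List.length_cons, sum_boxFillingsFrom_cons, ih fun k' => f (a :: k'), zero_smul, add_zero]

/-! ### Sums over indices of fixed length and weight -/

theorem sum_antidiagonalTuple_succ {M : Type*} [AddCommMonoid M] (r l : ℕ)
    (f : (Fin (r + 1) → ℕ) → M) :
    ∑ κ ∈ Finset.Nat.antidiagonalTuple (r + 1) l, f κ =
      ∑ p ∈ antidiagonal l, ∑ κ ∈ Finset.Nat.antidiagonalTuple r p.2, f (Fin.cons p.1 κ) := by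
  rw [Finset.sum_sigma']
  refine Finset.sum_bij' (fun κ _ => ⟨(κ 0, ∑ i, Fin.tail κ i), Fin.tail κ⟩)
    (fun x _ => Fin.cons x.1.1 x.2) ?_ ?_ ?_ ?_ ?_
  · intro κ hκ
    rw [Finset.Nat.mem_antidiagonalTuple, Fin.sum_univ_succ] at hκ
    simp [Finset.Nat.mem_antidiagonalTuple, Fin.tail, hκ]
  · rintro ⟨p, κ⟩ h
    simp only [Finset.mem_sigma, HasAntidiagonal.mem_antidiagonal, Finset.Nat.mem_antidiagonalTuple] at h
    simp [Finset.Nat.mem_antidiagonalTuple, Fin.sum_univ_succ, h.1, h.2]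
  · intro κ _
    exact Fin.cons_self_tail κ
  · rintro ⟨⟨a, b⟩, κ⟩ h
    simp only [Finset.mem_sigma, HasAntidiagonal.mem_antidiagonal, Finset.Nat.mem_antidiagonalTuple] at h
    obtain ⟨-, rfl⟩ := h
    simp
  · intro κ _
    rw [Fin.cons_self_tail]

/-- The sum of the operators `boxOp` over all `κ + 1` with `κ` of length `r` and sum `l`. -/
noncomputable def boxSum (t : ℝ) (r l : ℕ) : Module.End ℝ ℝ⟦X⟧ :=
  ∑ κ ∈ Finset.Nat.antidiagonalTuple r l, boxOp t (List.ofFn fun i => κ i + 1)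

theorem boxSum_zero_zero (t : ℝ) : boxSum t 0 0 = 1 := by
  simp [boxSum, boxOp]

theorem boxSum_zero_succ (t : ℝ) (l : ℕ) : boxSum t 0 (l + 1) = 0 := by
  simp [boxSum]

theorem boxSum_succ (t : ℝ) (r l : ℕ) :
    boxSum t (r + 1) l = ∑ p ∈ antidiagonal l,
      boxSum t r p.2 * (divIndex ^ (p.1 + 1) * (strictSum + t • 1)) := by
  rw [boxSum, sum_antidiagonalTuple_succ]
  refine Finset.sum_congr rfl fun p _ => ?_
  rw [boxSum, Finset.sum_mul]
  refine Finset.sum_congr rfl fun κ _ => ?_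
  simp [List.ofFn_succ, boxOp]

/-- The right factor `c` is arbitrary so that the step serves both the induction on `r` and the
passage to `tPolylogSum`. -/
theorem boxSum_conv_step {t : ℝ} {r : ℕ} {c : ℕ → Module.End ℝ ℝ⟦X⟧}
    (h0 : boxSum t (r + 1) 0 = divIndex * (strictSum + t • 1) * boxSum t r 0)
    (hs : ∀ l, boxSum t (r + 1) (l + 1) =
      divIndex * boxSum t (r + 1) l + divIndex * (strictSum + t • 1) * boxSum t r (l + 1)) (l : ℕ) :
    ∑ p ∈ antidiagonal (l + 1), boxSum t (r + 1) p.2 * c p.1 =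
      divIndex * ∑ p ∈ antidiagonal l, boxSum t (r + 1) p.2 * c p.1 +
      divIndex * (strictSum + t • 1) * ∑ p ∈ antidiagonal (l + 1), boxSum t r p.2 * c p.1 := by
  rw [Finset.Nat.sum_antidiagonal_succ', Finset.Nat.sum_antidiagonal_succ', h0]
  simp only [hs, add_mul, Finset.sum_add_distrib, mul_add, Finset.mul_sum, mul_assoc]
  abel

/-- `boxSum_succ` peels off the first entry, but differentiation acts on the last one, the leftmost
factor. If that entry exceeds `1`, one `divIndex` comes out; if it equals `1`, its whole factor
does. Peeling first entries leaves this untouched, hence induction on `r`. -/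
theorem boxSum_succ_zero_and_succ (t : ℝ) (r : ℕ) :
    boxSum t (r + 1) 0 = divIndex * (strictSum + t • 1) * boxSum t r 0 ∧
    ∀ l, boxSum t (r + 1) (l + 1) =
      divIndex * boxSum t (r + 1) l + divIndex * (strictSum + t • 1) * boxSum t r (l + 1) := by
  induction r with
  | zero =>
    have h1 : ∀ l, boxSum t 1 l = divIndex ^ (l + 1) * (strictSum + t • 1) := by
      intro l
      rw [boxSum_succ]
      cases l with
      | zero => simp [boxSum_zero_zero]
      | succ l =>
        rw [Finset.Nat.sum_antidiagonal_succ']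
        simp [boxSum_zero_zero, boxSum_zero_succ]
    refine ⟨?_, fun l => ?_⟩
    · rw [h1, boxSum_zero_zero]; simp
    · rw [h1, h1, boxSum_zero_succ, mul_zero, add_zero, ← mul_assoc, ← pow_succ']
  | succ r ih =>
    refine ⟨?_, fun l => ?_⟩
    · rw [boxSum_succ t (r + 1)]
      conv_rhs => rw [boxSum_succ t r]
      simp only [Finset.Nat.antidiagonal_zero, Finset.sum_singleton, ih.1, mul_assoc]
    · rw [boxSum_succ t (r + 1), boxSum_conv_step
        (c := fun a => divIndex ^ (a + 1) * (strictSum + t • 1)) ih.1 ih.2, ← boxSum_succ, ← boxSum_succ]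

/-! ### Differential recursion for the interpolated polylogarithms -/

/-- The sum over all `κ` of length `r + 1` and sum `l` of the generating series of the
`t`-interpolated multiple polylogarithms of the indices `κ + 1`. -/
noncomputable def tPolylogSum (t : ℝ) (r l : ℕ) : ℝ⟦X⟧ :=
  ∑ p ∈ antidiagonal l, boxSum t r p.2 ((divIndex ^ (p.1 + 1)) (strictSum 1))

theorem tPolylogSum_eq_apply (t : ℝ) (r l : ℕ) :
    tPolylogSum t r l =
      (∑ p ∈ antidiagonal l, boxSum t r p.2 * (divIndex ^ (p.1 + 1) * strictSum)) 1 := by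
  simp [tPolylogSum, LinearMap.sum_apply]

theorem tPolylogSum_zero (t : ℝ) (l : ℕ) :
    tPolylogSum t 0 l = (divIndex ^ (l + 1)) (strictSum 1) := by
  rw [tPolylogSum]
  cases l with
  | zero => simp [boxSum_zero_zero]
  | succ l =>
    rw [Finset.Nat.sum_antidiagonal_succ']
    simp [boxSum_zero_zero, boxSum_zero_succ]

theorem tPolylogSum_succ_zero (t : ℝ) (r : ℕ) :
    tPolylogSum t (r + 1) 0 =
      divIndex (strictSum (tPolylogSum t r 0) + t • tPolylogSum t r 0) := by
  simp [tPolylogSum, (boxSum_succ_zero_and_succ t r).1]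

theorem tPolylogSum_succ_succ (t : ℝ) (r l : ℕ) :
    tPolylogSum t (r + 1) (l + 1) = divIndex (tPolylogSum t (r + 1) l) +
      divIndex (strictSum (tPolylogSum t r (l + 1)) + t • tPolylogSum t r (l + 1)) := by
  rw [tPolylogSum_eq_apply, boxSum_conv_step (c := fun a => divIndex ^ (a + 1) * strictSum)
    (boxSum_succ_zero_and_succ t r).1
    (boxSum_succ_zero_and_succ t r).2, LinearMap.add_apply, Module.End.mul_apply, mul_assoc,
    Module.End.mul_apply, Module.End.mul_apply, ← tPolylogSum_eq_apply, ← tPolylogSum_eq_apply]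
  rfl

theorem coeff_zero_tPolylogSum (t : ℝ) (r l : ℕ) : coeff 0 (tPolylogSum t r l) = 0 := by
  cases r with
  | zero => rw [tPolylogSum_zero, coeff_zero_divIndex_pow_strictSum]
  | succ r =>
    cases l with
    | zero => rw [tPolylogSum_succ_zero, coeff_zero_divIndex]
    | succ l => rw [tPolylogSum_succ_succ, map_add, coeff_zero_divIndex, coeff_zero_divIndex,
        add_zero]

theorem eulerDeriv_tPolylogSum_zero_zero (t : ℝ) :
    eulerDeriv (tPolylogSum t 0 0) = geomTail := by
  rw [tPolylogSum_zero, eulerDeriv_divIndex_pow_strictSum]; simp [strictSum_apply]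

theorem eulerDeriv_tPolylogSum_zero_succ (t : ℝ) (l : ℕ) :
    eulerDeriv (tPolylogSum t 0 (l + 1)) = tPolylogSum t 0 l := by
  rw [tPolylogSum_zero, eulerDeriv_divIndex_pow_strictSum, tPolylogSum_zero]

theorem eulerDeriv_tPolylogSum_succ_zero (t : ℝ) (r : ℕ) :
    eulerDeriv (tPolylogSum t (r + 1) 0) =
      geomTail * tPolylogSum t r 0 + t • tPolylogSum t r 0 := by
  rw [tPolylogSum_succ_zero, eulerDeriv_divIndex, strictSum_apply]
  rw [map_add, coeff_zero_strictSum, map_smul, coeff_zero_tPolylogSum, smul_zero, add_zero]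

theorem eulerDeriv_tPolylogSum_succ_succ (t : ℝ) (r l : ℕ) :
    eulerDeriv (tPolylogSum t (r + 1) (l + 1)) = tPolylogSum t (r + 1) l +
      (geomTail * tPolylogSum t r (l + 1) + t • tPolylogSum t r (l + 1)) := by
  rw [tPolylogSum_succ_succ, map_add, eulerDeriv_divIndex (coeff_zero_tPolylogSum _ _ _),
    eulerDeriv_divIndex, strictSum_apply]
  rw [map_add, coeff_zero_strictSum, map_smul, coeff_zero_tPolylogSum, smul_zero, add_zero]

/-! ### Divided powers of the logarithm -/

/-- The generating series of the multiple polylogarithm of the index `{1}ᵐ`. -/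
noncomputable def onesSeries (m : ℕ) : ℝ⟦X⟧ := ((divIndex * strictSum) ^ m) 1

theorem onesSeries_zero : onesSeries 0 = 1 := rfl

theorem onesSeries_succ (m : ℕ) : onesSeries (m + 1) = divIndex (strictSum (onesSeries m)) := by
  rw [onesSeries, pow_succ', Module.End.mul_apply, Module.End.mul_apply]; rfl

theorem eulerDeriv_onesSeries_succ (m : ℕ) :
    eulerDeriv (onesSeries (m + 1)) = geomTail * onesSeries m := by
  rw [onesSeries_succ, eulerDeriv_divIndex (coeff_zero_strictSum _), strictSum_apply]

theorem coeff_zero_onesSeries_succ (m : ℕ) : coeff 0 (onesSeries (m + 1)) = 0 := by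
  rw [onesSeries_succ, coeff_zero_divIndex]

/-- `onesSeries 1` is `-log (1 - X)`, and its divided powers satisfy the differential recursion that
defines `onesSeries`. -/
theorem onesSeries_eq_pow (m : ℕ) :
    onesSeries m = (1 / (m.factorial : ℝ)) • onesSeries 1 ^ m := by
  induction m with
  | zero => simp [onesSeries_zero]
  | succ m ih =>
    refine eq_of_eulerDeriv_eq ?_ ?_
    · rw [eulerDeriv_onesSeries_succ, Derivation.map_smul, Derivation.leibniz_pow,
        eulerDeriv_onesSeries_succ, ih, onesSeries_zero, Nat.factorial_succ, Nat.add_sub_cancel,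
        mul_one, ← Nat.cast_smul_eq_nsmul ℝ, smul_smul, smul_eq_mul, mul_comm geomTail,
        smul_mul_assoc]
      congr 1
      push_cast
      field_simp
    · have h := coeff_zero_onesSeries_succ 0
      rw [zero_add, coeff_zero_eq_constantCoeff] at h
      rw [coeff_zero_onesSeries_succ, map_smul, coeff_zero_eq_constantCoeff, map_pow, h]
      simp

theorem onesSeries_mul (m r : ℕ) :
    onesSeries m * onesSeries r = ((m + r).choose m : ℝ) • onesSeries (m + r) := by
  rw [onesSeries_eq_pow m, onesSeries_eq_pow r, onesSeries_eq_pow (m + r), smul_mul_smul_comm,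
    ← pow_add, smul_smul, Nat.cast_add_choose]
  congr 1
  field_simp

theorem coeff_zero_mul_onesSeries_tPolylogSum (t : ℝ) (m r l : ℕ) :
    coeff 0 (onesSeries m * tPolylogSum t r l) = 0 := by
  have := coeff_zero_tPolylogSum t r l
  rw [coeff_zero_eq_constantCoeff] at this ⊢
  rw [map_mul, this, mul_zero]

/-! ### The identity of power series -/

/-- The alternating product sum `∑ (-1)ᵐ Li_{{1}ᵐ} F_{r, l}` over `r + m = k`. -/
noncomputable def productSide (t : ℝ) (k l : ℕ) : ℝ⟦X⟧ :=
  ∑ p ∈ antidiagonal k, (-1 : ℝ) ^ p.2 • (onesSeries p.2 * tPolylogSum t p.1 l)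

/-- The sum `∑ (-1)ᵃ tᵇ C(b + l, b) Li_{{1}ᵃ, b + l + 1}` over `a + b = k`. -/
noncomputable def polylogSide (t : ℝ) (k l : ℕ) : ℝ⟦X⟧ :=
  ∑ p ∈ antidiagonal k, ((-1 : ℝ) ^ p.1 * t ^ p.2 * ((p.2 + l).choose p.2 : ℝ)) •
    (divIndex ^ (p.2 + l + 1)) (strictSum (onesSeries p.1))

theorem coeff_zero_productSide (t : ℝ) (k l : ℕ) : coeff 0 (productSide t k l) = 0 := by
  rw [productSide, map_sum]
  refine Finset.sum_eq_zero fun p _ => ?_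
  rw [map_smul, coeff_zero_mul_onesSeries_tPolylogSum, smul_zero]

theorem coeff_zero_polylogSide (t : ℝ) (k l : ℕ) : coeff 0 (polylogSide t k l) = 0 := by
  rw [polylogSide, map_sum]
  refine Finset.sum_eq_zero fun p _ => ?_
  rw [map_smul, coeff_zero_divIndex_pow_strictSum, smul_zero]


/-- Product rule: differentiating `onesSeries (m + 1)` shifts `m` and flips the sign, so it cancels
the `geomTail` part of the derivative of `F`. Leaving `G` free covers `l = 0` and `l > 0` together.
-/
theorem eulerDeriv_alternating_sum {t : ℝ} {F G : ℕ → ℝ⟦X⟧} (h0 : eulerDeriv (F 0) = G 0)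
    (hs : ∀ r, eulerDeriv (F (r + 1)) = G (r + 1) + (geomTail * F r + t • F r)) (k : ℕ) :
    eulerDeriv (∑ p ∈ antidiagonal (k + 1), (-1 : ℝ) ^ p.2 • (onesSeries p.2 * F p.1)) =
      ∑ p ∈ antidiagonal (k + 1), (-1 : ℝ) ^ p.2 • (onesSeries p.2 * G p.1) +
      t • ∑ p ∈ antidiagonal k, (-1 : ℝ) ^ p.2 • (onesSeries p.2 * F p.1) := by
  have h1 : ∑ p ∈ antidiagonal (k + 1), (-1 : ℝ) ^ p.2 • (onesSeries p.2 * eulerDeriv (F p.1)) =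
      ∑ p ∈ antidiagonal (k + 1), (-1 : ℝ) ^ p.2 • (onesSeries p.2 * G p.1) +
      ∑ p ∈ antidiagonal k, (-1 : ℝ) ^ p.2 • (onesSeries p.2 * (geomTail * F p.1 + t • F p.1)) := by
    rw [Finset.Nat.sum_antidiagonal_succ, Finset.Nat.sum_antidiagonal_succ]
    simp only [h0, hs]
    rw [add_assoc, ← Finset.sum_add_distrib]
    simp only [mul_add, smul_add]
  have h2 : ∑ p ∈ antidiagonal (k + 1), (-1 : ℝ) ^ p.2 • (F p.1 * eulerDeriv (onesSeries p.2)) =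
      -∑ p ∈ antidiagonal k, (-1 : ℝ) ^ p.2 • (onesSeries p.2 * (geomTail * F p.1)) := by
    rw [Finset.Nat.sum_antidiagonal_succ', onesSeries_zero, Derivation.map_one_eq_zero,
      mul_zero, smul_zero, zero_add, ← Finset.sum_neg_distrib]
    refine Finset.sum_congr rfl fun p _ => ?_
    rw [eulerDeriv_onesSeries_succ, pow_succ, mul_neg_one, neg_smul]
    congr 2
    ring
  simp only [map_sum, Derivation.map_smul, Derivation.leibniz, smul_eq_mul, smul_add,
    Finset.sum_add_distrib]
  rw [h1, h2]
  simp only [mul_add, smul_add, Finset.sum_add_distrib, Finset.smul_sum, mul_smul_comm,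
    smul_comm t]
  abel

theorem eulerDeriv_productSide_zero_zero (t : ℝ) : eulerDeriv (productSide t 0 0) = geomTail := by
  simp [productSide, onesSeries_zero, eulerDeriv_tPolylogSum_zero_zero]

theorem eulerDeriv_productSide_zero_succ (t : ℝ) (l : ℕ) :
    eulerDeriv (productSide t 0 (l + 1)) = productSide t 0 l := by
  simp [productSide, onesSeries_zero, eulerDeriv_tPolylogSum_zero_succ]

theorem eulerDeriv_productSide_succ_zero (t : ℝ) (k : ℕ) :
    eulerDeriv (productSide t (k + 1) 0) =
      (-1 : ℝ) ^ (k + 1) • (geomTail * onesSeries (k + 1)) + t • productSide t k 0 := by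
  -- At `l = 0` there is no lower level; only `r = 0` has a source term, `geomTail`.
  rw [productSide, eulerDeriv_alternating_sum (t := t) (F := fun r => tPolylogSum t r 0)
    (G := fun r => if r = 0 then geomTail else 0), ← productSide, Finset.Nat.sum_antidiagonal_succ]
  · simp [mul_comm]
  · exact eulerDeriv_tPolylogSum_zero_zero t
  · intro r
    simp [eulerDeriv_tPolylogSum_succ_zero]

theorem eulerDeriv_productSide_succ_succ (t : ℝ) (k l : ℕ) :
    eulerDeriv (productSide t (k + 1) (l + 1)) =
      productSide t (k + 1) l + t • productSide t k (l + 1) := by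
  rw [productSide, eulerDeriv_alternating_sum (t := t) (F := fun r => tPolylogSum t r (l + 1))
    (G := fun r => tPolylogSum t r l), ← productSide, ← productSide]
  · exact eulerDeriv_tPolylogSum_zero_succ t l
  · exact fun r => eulerDeriv_tPolylogSum_succ_succ t r l

theorem eulerDeriv_polylogSide (t : ℝ) (k l : ℕ) :
    eulerDeriv (polylogSide t k l) =
      ∑ p ∈ antidiagonal k, ((-1 : ℝ) ^ p.1 * t ^ p.2 * ((p.2 + l).choose p.2 : ℝ)) •
        (divIndex ^ (p.2 + l)) (strictSum (onesSeries p.1)) := by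
  simp only [polylogSide, map_sum, Derivation.map_smul, eulerDeriv_divIndex_pow_strictSum]

theorem eulerDeriv_polylogSide_zero_zero (t : ℝ) : eulerDeriv (polylogSide t 0 0) = geomTail := by
  simp [eulerDeriv_polylogSide, onesSeries_zero, strictSum_apply]

theorem eulerDeriv_polylogSide_zero_succ (t : ℝ) (l : ℕ) :
    eulerDeriv (polylogSide t 0 (l + 1)) = polylogSide t 0 l := by
  rw [eulerDeriv_polylogSide]
  simp [polylogSide]

theorem eulerDeriv_polylogSide_succ_zero (t : ℝ) (k : ℕ) :
    eulerDeriv (polylogSide t (k + 1) 0) =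
      (-1 : ℝ) ^ (k + 1) • (geomTail * onesSeries (k + 1)) + t • polylogSide t k 0 := by
  rw [eulerDeriv_polylogSide, Finset.Nat.sum_antidiagonal_succ', polylogSide, Finset.smul_sum]
  congr 1
  · simp [strictSum_apply]
  · refine Finset.sum_congr rfl fun p _ => ?_
    rw [smul_smul]
    simp only [add_zero, Nat.choose_self, pow_succ]
    congr 1
    ring

theorem eulerDeriv_polylogSide_succ_succ (t : ℝ) (k l : ℕ) :
    eulerDeriv (polylogSide t (k + 1) (l + 1)) =
      polylogSide t (k + 1) l + t • polylogSide t k (l + 1) := by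
  rw [eulerDeriv_polylogSide, Finset.Nat.sum_antidiagonal_succ', polylogSide,
    Finset.Nat.sum_antidiagonal_succ', polylogSide, Finset.smul_sum, add_assoc,
    ← Finset.sum_add_distrib]
  congr 1
  · simp
  · refine Finset.sum_congr rfl fun p _ => ?_
    have h1 : p.2 + 1 + (l + 1) = p.2 + (l + 1) + 1 := by ring
    have h2 : p.2 + 1 + l = p.2 + (l + 1) := by ring
    -- Both terms carry the same series, and Pascal's rule adds their coefficients.
    rw [smul_smul, h1, h2, ← add_smul, Nat.choose_succ_succ]
    congr 1
    push_cast
    ring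

theorem productSide_eq_polylogSide (t : ℝ) (k l : ℕ) : productSide t k l = polylogSide t k l := by
  induction k generalizing l with
  | zero =>
    induction l with
    | zero =>
      refine eq_of_eulerDeriv_eq ?_ (by rw [coeff_zero_productSide, coeff_zero_polylogSide])
      rw [eulerDeriv_productSide_zero_zero, eulerDeriv_polylogSide_zero_zero]
    | succ l ih =>
      refine eq_of_eulerDeriv_eq ?_ (by rw [coeff_zero_productSide, coeff_zero_polylogSide])
      rw [eulerDeriv_productSide_zero_succ, eulerDeriv_polylogSide_zero_succ, ih]
  | succ k ihk =>
    induction l with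
    | zero =>
      refine eq_of_eulerDeriv_eq ?_ (by rw [coeff_zero_productSide, coeff_zero_polylogSide])
      rw [eulerDeriv_productSide_succ_zero, eulerDeriv_polylogSide_succ_zero, ihk]
    | succ l ih =>
      refine eq_of_eulerDeriv_eq ?_ (by rw [coeff_zero_productSide, coeff_zero_polylogSide])
      rw [eulerDeriv_productSide_succ_succ, eulerDeriv_polylogSide_succ_succ, ihk, ih]

/-! ### From operators to nested sums -/

theorem polylogOp_append (k k' : List ℕ) : polylogOp (k ++ k') = polylogOp k' * polylogOp k := by
  induction k with
  | nil => simp [polylogOp]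
  | cons a k ih => rw [List.cons_append, polylogOp, ih, polylogOp, mul_assoc]

theorem polylogOp_replicate_one (a : ℕ) :
    polylogOp (List.replicate a 1) = (divIndex * strictSum) ^ a := by
  induction a with
  | zero => rfl
  | succ a ih => rw [List.replicate_succ, polylogOp, ih, pow_one, pow_succ]

theorem polylogOp_replicate_append (a b : ℕ) :
    polylogOp (List.replicate a 1 ++ [b]) 1 = (divIndex ^ b) (strictSum (onesSeries a)) := by
  rw [polylogOp_append, polylogOp_replicate_one]
  simp [polylogOp, onesSeries]

/-- Nonnegativity of all coefficients of a real power series. -/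
def NonnegCoeff (g : ℝ⟦X⟧) : Prop := ∀ n, 0 ≤ coeff n g

theorem NonnegCoeff.one : NonnegCoeff 1 := fun n => by
  rw [coeff_one]; split_ifs <;> norm_num

theorem NonnegCoeff.strictSum {g : ℝ⟦X⟧} (hg : NonnegCoeff g) : NonnegCoeff (strictSum g) :=
  fun n => by rw [coeff_strictSum]; exact Finset.sum_nonneg fun m _ => hg m

theorem NonnegCoeff.divIndex_pow {g : ℝ⟦X⟧} (hg : NonnegCoeff g) (a : ℕ) :
    NonnegCoeff ((divIndex ^ a) g) :=
  fun n => by rw [coeff_divIndex_pow]; exact div_nonneg (hg n) (by positivity)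

theorem NonnegCoeff.mul {f g : ℝ⟦X⟧} (hf : NonnegCoeff f) (hg : NonnegCoeff g) :
    NonnegCoeff (f * g) :=
  fun n => by rw [coeff_mul]; exact Finset.sum_nonneg fun p _ => mul_nonneg (hf _) (hg _)

theorem NonnegCoeff.polylogOp {g : ℝ⟦X⟧} (hg : NonnegCoeff g) (k : List ℕ) :
    NonnegCoeff (polylogOp k g) := by
  induction k generalizing g with
  | nil => exact hg
  | cons a k ih => exact ih (hg.strictSum.divIndex_pow a)

-- Summing out the smallest variable replaces `g` by `(divIndex ^ a) (strictSum g)`, so the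
-- induction needs general `g`. Values in `ENNReal` allow sums to be exchanged without convergence.
open scoped Classical in
theorem tsum_strictMono_eq_tsum_polylogOp (k : List ℕ) {g : ℝ⟦X⟧} (hg : NonnegCoeff g)
    (F : ℕ → ENNReal) :
    ∑' m : Fin (k.length + 1) → ℕ, (if StrictMono m then
      ENNReal.ofReal (coeff (m 0) g * ∏ i : Fin k.length, 1 / (m i.succ : ℝ) ^ k.get i) *
        F (m (Fin.last k.length)) else 0) =
    ∑' n, ENNReal.ofReal (coeff n (polylogOp k g)) * F n := by
  induction k generalizing g with
  | nil =>
    rw [← (Equiv.funUnique (Fin 1) ℕ).tsum_eq]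
    refine tsum_congr fun m => ?_
    have : Subsingleton (Fin (([] : List ℕ).length + 1)) := inferInstanceAs (Subsingleton (Fin 1))
    rw [if_pos (Subsingleton.strictMono _)]
    simp [polylogOp]
  | cons a k ih =>
    rw [polylogOp, Module.End.mul_apply, ← ih (g := (divIndex ^ a * strictSum) g)
      (hg.strictSum.divIndex_pow a)]
    refine ((Fin.consEquiv (n := k.length + 1) fun _ => ℕ).tsum_eq _).symm.trans ?_
    rw [ENNReal.tsum_prod', ENNReal.tsum_comm]
    refine tsum_congr fun m => ?_
    by_cases hm : StrictMono m
    · have hcons : ∀ x : ℕ, StrictMono (Fin.cons x m : Fin (k.length + 1 + 1) → ℕ) ↔ x < m 0 := by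
        intro x
        rw [Fin.strictMono_cons]
        exact ⟨fun h => h.1 0, fun h => ⟨fun j => h.trans_le (hm.monotone (Fin.zero_le j)), hm⟩⟩
      rw [if_pos hm, tsum_eq_sum (s := range (m 0))]
      · rw [Module.End.mul_apply, coeff_divIndex_pow, coeff_strictSum, Finset.sum_div,
          Finset.sum_mul, ENNReal.ofReal_sum_of_nonneg, Finset.sum_mul]
        · refine Finset.sum_congr rfl fun x hx => ?_
          have hx' : StrictMono (Fin.consEquiv (fun _ : Fin (k.length + 1 + 1) => ℕ) (x, m)) :=
            (hcons x).2 (Finset.mem_range.1 hx)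
          refine (if_pos hx').trans ?_
          congr 2
          change coeff x g * ∏ i : Fin (k.length + 1), 1 / (m i : ℝ) ^ (a :: k).get i = _
          rw [Fin.prod_univ_succ]
          simp only [List.get_cons_zero, List.get_cons_succ', ← mul_assoc, mul_one_div]
        · intro x _
          exact mul_nonneg (div_nonneg (hg x) (by positivity))
            (Finset.prod_nonneg fun i _ => by positivity)
      · intro x hx
        refine if_neg fun h => hx (Finset.mem_range.2 ((hcons x).1 h))
    · rw [if_neg hm]
      refine ENNReal.tsum_eq_zero.2 fun x => if_neg fun h => hm ?_
      exact (Fin.strictMono_cons.1 h).2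

theorem tsum_index_eq_tsum_polylogOp (a : ℕ) (k : List ℕ) (F : ℕ → ENNReal) :
    ∑' m : {m : Fin (k.length + 1) → ℕ // StrictMono m ∧ ∀ i, 0 < m i},
      ENNReal.ofReal (1 / ∏ i, (m.1 i : ℝ) ^ (a :: k).get i) * F (m.1 (Fin.last k.length)) =
    ∑' n, ENNReal.ofReal (coeff n (polylogOp (a :: k) 1)) * F n := by
  classical
  rw [polylogOp, Module.End.mul_apply, ← tsum_strictMono_eq_tsum_polylogOp k
    (g := (divIndex ^ a * strictSum) 1) (NonnegCoeff.one.strictSum.divIndex_pow a)]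
  refine (tsum_subtype {m : Fin (k.length + 1) → ℕ | StrictMono m ∧ ∀ i, 0 < m i}
    (fun m => ENNReal.ofReal (1 / ∏ i, (m i : ℝ) ^ (a :: k).get i) *
      F (m (Fin.last k.length)))).trans (tsum_congr fun m => ?_)
  rw [Set.indicator_apply, Module.End.mul_apply, coeff_divIndex_pow,
    coeff_strictSum]
  by_cases hm : StrictMono m
  · rw [if_pos hm]
    rcases Nat.eq_zero_or_pos (m 0) with h0 | h0
    · rw [if_neg fun h => (h.2 0).ne' h0]
      -- The partial sum below `0` is empty: this encodes positivity of the smallest variable.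
      simp [h0]
    · rw [if_pos ⟨hm, fun i => h0.trans_le (hm.monotone (Fin.zero_le i))⟩]
      congr 2
      have h1 : ∑ x ∈ range (m 0), coeff x (1 : ℝ⟦X⟧) = 1 := by
        simp [coeff_one, h0]
      rw [h1, one_div, ← Finset.prod_inv_distrib]
      rw [Fin.prod_univ_succ]
      simp
  · rw [if_neg hm, if_neg fun h => hm h.1]

theorem multiZeta_cons (a : ℕ) (k : List ℕ) :
    multiZeta (a :: k) = ∑' n, coeff n (polylogOp (a :: k) 1) := by
  have h := congrArg ENNReal.toReal (tsum_index_eq_tsum_polylogOp a k 1)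
  simp only [Pi.one_apply, mul_one] at h
  -- Convergence is not needed: `toReal ⊤ = 0` agrees with the default value of a divergent real
  -- `tsum`.
  rw [ENNReal.tsum_toReal_eq fun _ => ENNReal.ofReal_ne_top,
    ENNReal.tsum_toReal_eq fun _ => ENNReal.ofReal_ne_top] at h
  simp only [ENNReal.toReal_ofReal (NonnegCoeff.one.polylogOp (a :: k) _)] at h
  rw [← h, multiZeta]
  refine tsum_congr fun m => (ENNReal.toReal_ofReal ?_).symm
  positivity

theorem multiPolylog_cons (a : ℕ) (k : List ℕ) {z : ℝ} (hz : 0 ≤ z) :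
    multiPolylog (a :: k) z = ∑' n, coeff n (polylogOp (a :: k) 1) * z ^ n := by
  have h := congrArg ENNReal.toReal
    (tsum_index_eq_tsum_polylogOp a k fun n => ENNReal.ofReal (z ^ n))
  rw [ENNReal.tsum_toReal_eq fun _ => ENNReal.mul_ne_top ENNReal.ofReal_ne_top
      ENNReal.ofReal_ne_top,
    ENNReal.tsum_toReal_eq fun _ => ENNReal.mul_ne_top ENNReal.ofReal_ne_top
      ENNReal.ofReal_ne_top] at h
  simp only [ENNReal.toReal_mul, ENNReal.toReal_ofReal (NonnegCoeff.one.polylogOp (a :: k) _),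
    ENNReal.toReal_ofReal (pow_nonneg hz _)] at h
  rw [← h, multiPolylog]
  refine tsum_congr fun m => ?_
  rw [ENNReal.toReal_ofReal (by positivity), div_eq_mul_one_div, mul_comm]

theorem NonnegCoeff.onesSeries (m : ℕ) : NonnegCoeff (onesSeries m) := by
  have := NonnegCoeff.one.polylogOp (List.replicate m 1)
  rwa [polylogOp_replicate_one] at this

/-! ### Growth of coefficients and summability -/

/-- The difference of roots is `1 / (√(m+1) + √m)`, and `√(m+1) ≤ 2 * √m` gives the constant `3`. -/
theorem one_div_sqrt_le (m : ℕ) (hm : 0 < m) :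
    1 / √(m : ℝ) ≤ 3 * (√((m + 1 : ℕ) : ℝ) - √(m : ℝ)) := by
  have hm' : (1 : ℝ) ≤ m := by exact_mod_cast hm
  have h0 : 0 < √(m : ℝ) := Real.sqrt_pos.2 (by linarith)
  have h1 : √((m + 1 : ℕ) : ℝ) ≤ 2 * √(m : ℝ) := by
    rw [Real.sqrt_le_left (by positivity), mul_pow, Real.sq_sqrt (by linarith)]
    push_cast; linarith
  have h2 : √((m + 1 : ℕ) : ℝ) ^ 2 = m + 1 := by
    rw [Real.sq_sqrt (by positivity)]; push_cast; ring
  have h3 : √(m : ℝ) ^ 2 = m := Real.sq_sqrt (by linarith)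
  have h4 : √(m : ℝ) ≤ √((m + 1 : ℕ) : ℝ) := Real.sqrt_le_sqrt (by push_cast; linarith)
  rw [div_le_iff₀ h0]
  nlinarith

/-- The true growth is a power of a logarithm; `√N` is a crude bound that reproduces itself, since a
partial sum `≤ C * √N` divided by `N` is `≤ C / √N`, which telescopes. -/
theorem exists_sum_onesSeries_le (r : ℕ) :
    ∃ C : ℝ, 0 ≤ C ∧ ∀ N : ℕ, ∑ m ∈ range N, coeff m (onesSeries r) ≤ C * √(N : ℝ) := by
  induction r with
  | zero =>
    refine ⟨1, zero_le_one, fun N => ?_⟩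
    rw [onesSeries_zero, one_mul]
    rcases Nat.eq_zero_or_pos N with rfl | hN
    · simp
    · have h1 : ∑ x ∈ range N, coeff x (1 : ℝ⟦X⟧) = 1 := by
        simp [coeff_one, hN]
      rw [h1, Real.one_le_sqrt]
      exact_mod_cast hN
  | succ r ih =>
    obtain ⟨C, hC, h⟩ := ih
    refine ⟨3 * C, by positivity, fun N => ?_⟩
    induction N with
    | zero => simp
    | succ N ihN =>
      rw [Finset.sum_range_succ]
      rcases Nat.eq_zero_or_pos N with rfl | hN
      · rw [coeff_zero_onesSeries_succ]
        simp only [range_zero, sum_empty, add_zero]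
        positivity
      · have h1 : coeff N (onesSeries (r + 1)) ≤ C * (1 / √(N : ℝ)) := by
          rw [onesSeries_succ, coeff_divIndex, coeff_strictSum, ← Real.sqrt_div_self',
            ← mul_div_assoc]
          exact div_le_div_of_nonneg_right (h N) (by positivity)
        have h2 := mul_le_mul_of_nonneg_left (one_div_sqrt_le N hN) hC
        linarith

theorem summable_coeff_onesSeries_div (r : ℕ) :
    Summable fun n : ℕ => coeff n (onesSeries r) / n := by
  cases r with
  | zero =>
    refine summable_of_ne_finset_zero (s := ∅) fun n _ => ?_
    rw [onesSeries_zero, coeff_one]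
    split_ifs with h <;> simp [h]
  | succ r =>
    obtain ⟨C, hC, h⟩ := exists_sum_onesSeries_le r
    have hs : Summable fun n : ℕ => C * (1 / (n : ℝ) ^ (3 / 2 : ℝ)) :=
      (Real.summable_one_div_nat_rpow.2 (by norm_num)).mul_left C
    refine hs.of_nonneg_of_le
      (fun n => div_nonneg (NonnegCoeff.onesSeries _ n) (by positivity)) fun n => ?_
    rcases Nat.eq_zero_or_pos n with rfl | hn
    · simp only [CharP.cast_eq_zero, div_zero]
      positivity
    · have hn' : (0 : ℝ) < n := by exact_mod_cast hn
      rw [onesSeries_succ, coeff_divIndex, coeff_strictSum, div_div, mul_one_div]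
      have h3 : (n : ℝ) ^ (3 / 2 : ℝ) * √(n : ℝ) = n * n := by
        rw [Real.sqrt_eq_rpow, ← Real.rpow_add hn']
        norm_num
        ring
      have h4 : 0 < (n : ℝ) ^ (3 / 2 : ℝ) := by positivity
      rw [div_le_div_iff₀ (by positivity) h4, ← h3]
      calc _ ≤ (C * √(n : ℝ)) * (n : ℝ) ^ (3 / 2 : ℝ) :=
            mul_le_mul_of_nonneg_right (h n) h4.le
        _ = _ := by ring

/-- Lowering every exponent to `1` only increases coefficients. -/
theorem coeff_polylogOp_le {k : List ℕ} (hk : ∀ a ∈ k, 1 ≤ a) {g g' : ℝ⟦X⟧} (hg : NonnegCoeff g)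
    (h : ∀ n, coeff n g ≤ coeff n g') (n : ℕ) :
    coeff n (polylogOp k g) ≤ coeff n (((divIndex * strictSum) ^ k.length) g') := by
  induction k generalizing g g' with
  | nil => exact h n
  | cons a k ih =>
    rw [polylogOp, List.length_cons, pow_succ, Module.End.mul_apply (polylogOp k),
      Module.End.mul_apply (_ ^ _)]
    refine ih (fun b hb => hk b (List.mem_cons_of_mem a hb)) (hg.strictSum.divIndex_pow a)
      fun n => ?_
    rw [Module.End.mul_apply, coeff_divIndex_pow, coeff_divIndex,
      coeff_strictSum, coeff_strictSum]
    rcases Nat.eq_zero_or_pos n with rfl | hn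
    · simp
    · have hn' : (1 : ℝ) ≤ n := by exact_mod_cast hn
      have ha : a ≠ 0 := Nat.one_le_iff_ne_zero.1 (hk a List.mem_cons_self)
      refine div_le_div₀ (Finset.sum_nonneg fun m _ => (hg m).trans (h m))
        (Finset.sum_le_sum fun m _ => h m) (by linarith) (le_self_pow₀ hn' ha)

theorem coeff_polylogOp_one_le {k : List ℕ} (hk : ∀ a ∈ k, 1 ≤ a) (n : ℕ) :
    coeff n (polylogOp k 1) ≤ coeff n (onesSeries k.length) :=
  coeff_polylogOp_le hk NonnegCoeff.one (fun _ => le_rfl) n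

/-- Domination by `onesSeries m * onesSeries k.length`, which `onesSeries_mul` turns back into a
multiple of a single `onesSeries`. -/
theorem summable_coeff_onesSeries_mul_polylogOp_div (m : ℕ) {k : List ℕ} (hk : ∀ a ∈ k, 1 ≤ a) :
    Summable fun n : ℕ => coeff n (onesSeries m * polylogOp k 1) / n := by
  refine ((summable_coeff_onesSeries_div (m + k.length)).mul_left
    ((m + k.length).choose m : ℝ)).of_nonneg_of_le (fun n => div_nonneg
      (((NonnegCoeff.onesSeries m).mul (NonnegCoeff.one.polylogOp k)) n) (by positivity))
    fun n => ?_
  rw [← mul_div_assoc]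
  refine div_le_div_of_nonneg_right ?_ (by positivity)
  have h : ((m + k.length).choose m : ℝ) * coeff n (onesSeries (m + k.length)) =
      coeff n (onesSeries m * onesSeries k.length) := by
    rw [onesSeries_mul, map_smul, smul_eq_mul]
  rw [h, coeff_mul, coeff_mul]
  exact Finset.sum_le_sum fun p _ => mul_le_mul_of_nonneg_left (coeff_polylogOp_one_le hk _)
    (NonnegCoeff.onesSeries m _)

/-! ### Values of the series at a point of `[0, 1)` -/

theorem hasSum_coeff_mul {f g : ℝ⟦X⟧} {z a b : ℝ}
    (ha : HasSum (fun n => coeff n f * z ^ n) a)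
    (hb : HasSum (fun n => coeff n g * z ^ n) b) :
    HasSum (fun n => coeff n (f * g) * z ^ n) (a * b) := by
  have hcoeff : (fun n => coeff n (f * g) * z ^ n) = fun n => ∑ p ∈ antidiagonal n,
      (coeff p.1 f * z ^ p.1) * (coeff p.2 g * z ^ p.2) := by
    ext n
    rw [coeff_mul, Finset.sum_mul]
    refine Finset.sum_congr rfl fun p hp => ?_
    rw [← HasAntidiagonal.mem_antidiagonal.1 hp, pow_add]
    ring
  have hsf := ha.summable.norm
  have hsg := hb.summable.norm
  rw [hcoeff, ← ha.tsum_eq, ← hb.tsum_eq,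
    tsum_mul_tsum_eq_tsum_sum_antidiagonal_of_summable_norm hsf hsg]
  exact (summable_norm_sum_mul_antidiagonal_of_summable_norm hsf hsg).of_norm.hasSum

theorem hasSum_onesSeries_one {z : ℝ} (hz : 0 ≤ z) (hz1 : z < 1) :
    HasSum (fun n => coeff n (onesSeries 1) * z ^ n) (-Real.log (1 - z)) := by
  have h := Real.hasSum_pow_div_log_of_abs_lt_one (abs_lt.2 ⟨by linarith, hz1⟩)
  rw [← hasSum_nat_add_iff' 1]
  simp only [Finset.sum_range_one, coeff_zero_onesSeries_succ 0, zero_mul, sub_zero]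
  convert! h using 2 with n
  rw [onesSeries_succ, coeff_divIndex, coeff_strictSum, onesSeries_zero]
  simp [coeff_one, div_eq_inv_mul]

theorem hasSum_onesSeries {z : ℝ} (hz : 0 ≤ z) (hz1 : z < 1) (m : ℕ) :
    HasSum (fun n => coeff n (onesSeries m) * z ^ n)
      ((-Real.log (1 - z)) ^ m / (m.factorial : ℝ)) := by
  have hpow : ∀ m, HasSum (fun n => coeff n (onesSeries 1 ^ m) * z ^ n) ((-Real.log (1 - z)) ^ m) := by
    intro m
    induction m with
    | zero =>
      rw [pow_zero, pow_zero]
      convert! hasSum_ite_eq (0 : ℕ) (1 : ℝ) using 2 with n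
      rw [coeff_one]
      split_ifs with h <;> simp [h]
    | succ m ih =>
      rw [pow_succ, pow_succ]
      exact hasSum_coeff_mul ih (hasSum_onesSeries_one hz hz1)
  convert! (hpow m).div_const (m.factorial : ℝ) using 2 with n
  rw [onesSeries_eq_pow, map_smul, smul_eq_mul]
  ring

theorem hasSum_multiPolylog (a : ℕ) {k : List ℕ} (hk : ∀ b ∈ a :: k, 1 ≤ b) {z : ℝ} (hz : 0 ≤ z)
    (hz1 : z < 1) :
    HasSum (fun n => coeff n (polylogOp (a :: k) 1) * z ^ n) (multiPolylog (a :: k) z) := by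
  rw [multiPolylog_cons a k hz]
  refine (((hasSum_onesSeries hz hz1 (a :: k).length).summable).of_nonneg_of_le
    (fun n => mul_nonneg (NonnegCoeff.one.polylogOp _ n) (pow_nonneg hz n)) fun n => ?_).hasSum
  exact mul_le_mul_of_nonneg_right (coeff_polylogOp_one_le hk n) (pow_nonneg hz n)

/-! ### The integral as a weighted coefficient sum -/

theorem integral_one_sub_exp_neg_pow (n : ℕ) :
    MeasureTheory.IntegrableOn
      (fun x : ℝ => (1 - Real.exp (-x)) ^ n * Real.exp (-x)) (Set.Ioi 0) ∧
    ∫ x in Set.Ioi (0 : ℝ), (1 - Real.exp (-x)) ^ n * Real.exp (-x) = 1 / ((n + 1 : ℕ) : ℝ) := by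
  have hn : ((n + 1 : ℕ) : ℝ) ≠ 0 := by positivity
  have hd : ∀ x ∈ Set.Ici (0 : ℝ), HasDerivAt
      (fun x : ℝ => (1 - Real.exp (-x)) ^ (n + 1) / ((n + 1 : ℕ) : ℝ))
      ((1 - Real.exp (-x)) ^ n * Real.exp (-x)) x := by
    intro x _
    have h1 : HasDerivAt (fun x : ℝ => 1 - Real.exp (-x)) (Real.exp (-x)) x := by
      convert! ((hasDerivAt_neg x).exp).const_sub 1 using 1
      ring
    convert! (h1.pow (n + 1)).div_const ((n + 1 : ℕ) : ℝ) using 1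
    rw [Nat.add_sub_cancel]
    field_simp
  have hnn : ∀ x ∈ Set.Ioi (0 : ℝ), 0 ≤ (1 - Real.exp (-x)) ^ n * Real.exp (-x) := by
    intro x hx
    have : Real.exp (-x) ≤ 1 := Real.exp_le_one_iff.2 (by linarith [Set.mem_Ioi.1 hx])
    exact mul_nonneg (pow_nonneg (by linarith) n) (Real.exp_pos _).le
  have ht : Filter.Tendsto (fun x : ℝ => (1 - Real.exp (-x)) ^ (n + 1) / ((n + 1 : ℕ) : ℝ))
      Filter.atTop (nhds ((1 - 0) ^ (n + 1) / ((n + 1 : ℕ) : ℝ))) :=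
    (((Real.tendsto_exp_neg_atTop_nhds_zero).const_sub 1).pow (n + 1)).div_const _
  refine ⟨MeasureTheory.integrableOn_Ioi_deriv_of_nonneg' hd hnn ht, ?_⟩
  rw [MeasureTheory.integral_Ioi_of_hasDerivAt_of_nonneg' hd hnn ht]
  simp

/-- Termwise integration; nonnegativity makes the integrals of norms equal to the given summable
terms. The truncated `n - 1` at `n = 0` is harmless because that coefficient vanishes. -/
theorem hasSum_integral_coeff {h : ℝ⟦X⟧} (hh : NonnegCoeff h) (h0 : coeff 0 h = 0)
    (hs : Summable fun n : ℕ => coeff n h / n) :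
    HasSum (fun n : ℕ => coeff n h / n) (∫ x in Set.Ioi (0 : ℝ),
      ∑' n, coeff n h * ((1 - Real.exp (-x)) ^ (n - 1) * Real.exp (-x))) := by
  have hval : ∀ n : ℕ, ∫ x in Set.Ioi (0 : ℝ),
      coeff n h * ((1 - Real.exp (-x)) ^ (n - 1) * Real.exp (-x)) = coeff n h / n := by
    intro n
    rw [MeasureTheory.integral_const_mul]
    cases n with
    | zero => rw [h0]; simp
    | succ n =>
      rw [Nat.add_sub_cancel, (integral_one_sub_exp_neg_pow n).2, mul_one_div]
  have key := MeasureTheory.hasSum_integral_of_summable_integral_norm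
    (μ := MeasureTheory.volume.restrict (Set.Ioi (0 : ℝ)))
    (F := fun (n : ℕ) x => coeff n h * ((1 - Real.exp (-x)) ^ (n - 1) * Real.exp (-x)))
    (fun n => (integral_one_sub_exp_neg_pow (n - 1)).1.const_mul _) ?_
  · simpa only [hval] using key
  · refine hs.congr fun n => ?_
    rw [← hval n]
    refine MeasureTheory.setIntegral_congr_fun measurableSet_Ioi fun x hx => ?_
    have : Real.exp (-x) ≤ 1 := Real.exp_le_one_iff.2 (by linarith [Set.mem_Ioi.1 hx])
    exact (Real.norm_of_nonneg (mul_nonneg (hh n)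
      (mul_nonneg (pow_nonneg (by linarith) _) (Real.exp_pos _).le))).symm

theorem hasSum_arakawaKaneko (a : ℕ) {k : List ℕ} (hk : ∀ b ∈ a :: k, 1 ≤ b) (m : ℕ) :
    HasSum (fun n : ℕ => coeff n (onesSeries m * polylogOp (a :: k) 1) / n)
      (arakawaKaneko (a :: k) ((m + 1 : ℕ) : ℝ)) := by
  have h0 : coeff 0 (onesSeries m * polylogOp (a :: k) 1) = 0 := by
    have h := coeff_polylogOp_one_le hk 0
    rw [List.length_cons, coeff_zero_onesSeries_succ] at h
    have h' := le_antisymm h (NonnegCoeff.one.polylogOp (a :: k) 0)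
    rw [coeff_zero_eq_constantCoeff] at h' ⊢
    rw [map_mul, h', mul_zero]
  have hnn := (NonnegCoeff.onesSeries m).mul (NonnegCoeff.one.polylogOp (a :: k))
  convert! hasSum_integral_coeff hnn h0 (summable_coeff_onesSeries_mul_polylogOp_div m hk) using 1
  rw [arakawaKaneko, ← MeasureTheory.integral_const_mul]
  refine MeasureTheory.setIntegral_congr_fun measurableSet_Ioi fun x hx => ?_
  have hx : 0 < x := hx
  have hz1 : 1 - Real.exp (-x) < 1 := by linarith [Real.exp_pos (-x)]
  have hz : 0 < 1 - Real.exp (-x) := by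
    have : Real.exp (-x) < 1 := Real.exp_lt_one_iff.2 (by linarith)
    linarith
  have hsum := hasSum_coeff_mul (hasSum_onesSeries hz.le hz1 m) (hasSum_multiPolylog a hk hz.le hz1)
  have hsum' := hsum.mul_right (1 / (Real.exp x - 1))
  -- This turns the value of `onesSeries m` into `x ^ m / m!`, which is the kernel `x ^ (s - 1) /
  -- Γ(s)` at `s = m + 1`.
  have hlog : -Real.log (1 - (1 - Real.exp (-x))) = x := by
    rw [sub_sub_cancel, Real.log_exp, neg_neg]
  have hexp : 1 / (Real.exp x - 1) = Real.exp (-x) / (1 - Real.exp (-x)) := by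
    rw [Real.exp_neg]
    have : Real.exp x - 1 ≠ 0 := by linarith [Real.add_one_lt_exp hx.ne']
    field_simp
  have hterm : ∀ n : ℕ, coeff n (onesSeries m * polylogOp (a :: k) 1) *
      ((1 - Real.exp (-x)) ^ (n - 1) * Real.exp (-x)) =
      coeff n (onesSeries m * polylogOp (a :: k) 1) * (1 - Real.exp (-x)) ^ n *
        (1 / (Real.exp x - 1)) := by
    intro n
    cases n with
    | zero => rw [h0]; simp
    | succ n =>
      rw [hexp, Nat.add_sub_cancel, pow_succ]
      field_simp
  simp only [hterm]
  rw [hsum'.tsum_eq, hlog, Nat.cast_add_one, Real.Gamma_nat_eq_factorial, add_sub_cancel_right,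
    Real.rpow_natCast]
  ring

/-! ### Applying the functional to both sides -/

theorem one_le_of_mem_boxFillingsFrom {a : ℕ} {k k' : List ℕ} (ha : 1 ≤ a)
    (hk : ∀ b ∈ k, 1 ≤ b) (h : k' ∈ boxFillingsFrom a k) :
    (∀ b ∈ k', 1 ≤ b) ∧ k' ≠ [] := by
  induction k generalizing a k' with
  | nil => simp_all [boxFillingsFrom]
  | cons b k ih =>
    have hk' : ∀ b ∈ k, 1 ≤ b := fun c hc => hk c (List.mem_cons_of_mem b hc)
    rw [boxFillingsFrom, List.mem_append, List.mem_map] at h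
    rcases h with ⟨k'', h, rfl⟩ | h
    · refine ⟨fun c hc => ?_, List.cons_ne_nil _ _⟩
      rcases List.mem_cons.1 hc with rfl | hc
      · exact ha
      · exact (ih (hk b List.mem_cons_self) hk' h).1 c hc
    · exact ih (le_add_right ha) hk' h

theorem hasSum_list_sum {ι α : Type*} (L : List ι) (f : ι → α → ℝ) (v : ι → ℝ)
    (h : ∀ i ∈ L, HasSum (f i) (v i)) :
    HasSum (fun n => (L.map fun i => f i n).sum) (L.map v).sum := by
  induction L with
  | nil => simp
  | cons i L ih =>
    simp only [List.map_cons, List.sum_cons]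
    exact (h i List.mem_cons_self).add (ih fun j hj => h j (List.mem_cons_of_mem i hj))

theorem hasSum_tArakawaKaneko (t : ℝ) {a : ℕ} {k : List ℕ} (ha : 1 ≤ a) (hk : ∀ b ∈ k, 1 ≤ b)
    (m : ℕ) :
    HasSum (fun n : ℕ =>
        coeff n (onesSeries m * boxOp t k ((divIndex ^ a) (strictSum 1))) / n)
      (tArakawaKaneko t (a :: k) (m + 1)) := by
  have h := hasSum_list_sum (boxFillingsFrom a k)
    (fun k' n => t ^ (k.length + 1 - k'.length) *
      (coeff n (onesSeries m * polylogOp k' 1) / n))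
    (fun k' => t ^ (k.length + 1 - k'.length) * arakawaKaneko k' ((m + 1 : ℕ) : ℝ))
    fun k' hk' => by
      obtain ⟨h1, h2⟩ := one_le_of_mem_boxFillingsFrom ha hk hk'
      obtain ⟨b, k'', rfl⟩ := List.exists_cons_of_ne_nil h2
      exact (hasSum_arakawaKaneko b h1 m).mul_left _
  convert! h using 2 with n
  rw [← sum_boxFillingsFrom_polylogOp]
  induction boxFillingsFrom a k with
  | nil => simp
  | cons k' L ih =>
    simp only [List.map_cons, List.sum_cons, mul_add, map_add, add_div, ih, mul_smul_comm,
      map_smul, smul_eq_mul, mul_div_assoc]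

theorem hasSum_sum_tArakawaKaneko (t : ℝ) (r l m : ℕ) :
    HasSum (fun n : ℕ => coeff n (onesSeries m * tPolylogSum t r l) / n)
      (∑ κ ∈ Finset.Nat.antidiagonalTuple (r + 1) l,
        tArakawaKaneko t (List.ofFn fun i => κ i + 1) (m + 1)) := by
  rw [sum_antidiagonalTuple_succ]
  have h := hasSum_sum (s := antidiagonal l) fun p _ =>
    hasSum_sum (s := Finset.Nat.antidiagonalTuple r p.2) fun κ _ =>
      hasSum_tArakawaKaneko t (a := p.1 + 1) (k := List.ofFn fun i => κ i + 1)
        (Nat.le_add_left 1 p.1) (by simp [List.mem_ofFn]) m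
  convert! h using 2 with n
  · simp only [tPolylogSum, boxSum, LinearMap.sum_apply, Finset.mul_sum, map_sum, Finset.sum_div]
  · simp [List.ofFn_succ]

theorem hasSum_productSide (t : ℝ) (k l : ℕ) :
    HasSum (fun n : ℕ => coeff n (productSide t k l) / n)
      (∑ p ∈ antidiagonal k, (-1 : ℝ) ^ p.2 * ∑ κ ∈ Finset.Nat.antidiagonalTuple (p.1 + 1) l,
        tArakawaKaneko t (List.ofFn fun i => κ i + 1) (p.2 + 1)) := by
  have h := hasSum_sum (s := antidiagonal k) fun p _ =>
    (hasSum_sum_tArakawaKaneko t p.1 l p.2).mul_left ((-1 : ℝ) ^ p.2)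
  convert! h using 2 with n
  simp only [productSide, map_sum, map_smul, smul_eq_mul, Finset.sum_div, mul_div_assoc]

theorem hasSum_multiZeta (a b : ℕ) :
    HasSum (fun n : ℕ => coeff n ((divIndex ^ (b + 1)) (strictSum (onesSeries a))) / n)
      (multiZeta (List.replicate a 1 ++ [b + 2])) := by
  -- The last entry is `b + 1` here: the division by `n` supplies the remaining unit of `b + 2`.
  have hs := summable_coeff_onesSeries_mul_polylogOp_div 0
    (k := List.replicate a 1 ++ [b + 1]) (by simp +contextual [or_imp])
  rw [onesSeries_zero, one_mul, polylogOp_replicate_append] at hs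
  obtain ⟨c, k, hck⟩ := List.exists_cons_of_ne_nil
    (List.append_ne_nil_of_right_ne_nil (List.replicate a 1) (List.cons_ne_nil (b + 2) []))
  rw [hck, multiZeta_cons, ← hck, polylogOp_replicate_append, pow_succ' _ (b + 1)]
  simp only [Module.End.mul_apply, coeff_divIndex]
  exact hs.hasSum

theorem hasSum_polylogSide (t : ℝ) (k l : ℕ) :
    HasSum (fun n : ℕ => coeff n (polylogSide t k l) / n)
      (∑ p ∈ antidiagonal k, (-1 : ℝ) ^ p.1 * t ^ p.2 * ((p.2 + l).choose p.2 : ℝ) *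
        multiZeta (List.replicate p.1 1 ++ [p.2 + l + 2])) := by
  have h := hasSum_sum (s := antidiagonal k) fun p _ => (hasSum_multiZeta p.1 (p.2 + l)).mul_left
    ((-1 : ℝ) ^ p.1 * t ^ p.2 * ((p.2 + l).choose p.2 : ℝ))
  convert! h using 2 with n
  simp only [polylogSide, map_sum, map_smul, smul_eq_mul, Finset.sum_div, mul_div_assoc]

theorem sum_tArakawaKaneko_eq_sum_multiZeta (t : ℝ) (k l : ℕ) :
    ∑ p ∈ antidiagonal k, (-1 : ℝ) ^ p.2 * ∑ κ ∈ Finset.Nat.antidiagonalTuple (p.1 + 1) l,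
        tArakawaKaneko t (List.ofFn fun i => κ i + 1) (p.2 + 1) =
      ∑ p ∈ antidiagonal k, (-1 : ℝ) ^ p.1 * t ^ p.2 * ((p.2 + l).choose p.2 : ℝ) *
        multiZeta (List.replicate p.1 1 ++ [p.2 + l + 2]) := by
  have h := hasSum_productSide t k l
  rw [productSide_eq_polylogSide] at h
  exact h.unique (hasSum_polylogSide t k l)

theorem tArakawaKaneko_zero (a : ℕ) (k : List ℕ) (m : ℕ) :
    tArakawaKaneko 0 (a :: k) m = arakawaKaneko (a :: k) m :=
  sum_boxFillingsFrom_zero (fun k' => arakawaKaneko k' m) a k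

theorem theorem4p8 (k l : ℕ) (t : ℝ) :
    (∑ p ∈ Finset.HasAntidiagonal.antidiagonal k, (-1 : ℝ) ^ p.2 *
        ∑ κ ∈ Finset.Nat.antidiagonalTuple (p.1 + 1) l,
          tArakawaKaneko t (List.ofFn fun i => κ i + 1) (p.2 + 1)
      = ∑ p ∈ Finset.HasAntidiagonal.antidiagonal k, (-1 : ℝ) ^ p.1 * t ^ p.2 * ((p.2 + l).choose p.2 : ℝ) *
          multiZeta (List.replicate p.1 1 ++ [p.2 + l + 2])) ∧
    (∑ p ∈ Finset.HasAntidiagonal.antidiagonal k, (-1 : ℝ) ^ p.2 *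
        ∑ κ ∈ Finset.Nat.antidiagonalTuple (p.1 + 1) l,
          arakawaKaneko (List.ofFn fun i => κ i + 1) ((p.2 + 1 : ℕ) : ℝ)
      = (-1 : ℝ) ^ k * multiZeta (List.replicate k 1 ++ [l + 2])) := by
  refine ⟨sum_tArakawaKaneko_eq_sum_multiZeta t k l, ?_⟩
  have h := sum_tArakawaKaneko_eq_sum_multiZeta 0 k l
  simp only [List.ofFn_succ, tArakawaKaneko_zero] at h ⊢
  rw [h]
  -- The factor `0 ^ p.2` leaves only the term with `p.2 = 0`.
  cases k with
  | zero => simp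
  | succ k =>
    rw [Finset.Nat.sum_antidiagonal_succ']
    simp
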